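/- **Setting.** Let $P_1,P_0$ be the population distributions of a document $Y$ given $W=1$ and given $W=0$. One observes $(Y_i,W_i)_{i=1}^n$ with $n_1$ treated units ($W_i=1$) and $n_0=n-n_1$ control units ($W_i=0$); given the labels $(W_i)_{i=1}^n$, the documents are independent with $Y_i\sim P_{W_i}$. The units are split into a hold-out set $\mathcal H$, which contains $h_1$ treated and $h_0$ control units with $0<h_1<n_1$ and $0<h_0<n_0$, and its complement, the training set $\mathcal T$; the group sizes and the split are held fixed (all statements are conditional on them). A random scoring function $\hat f$ (the learned themes) assigns to a document $Y$ the score vector $Y^{\hat f}=\hat f(Y)\in\mathbb R^k$; write $Y_i^{\hat f}=\hat f(Y_i)$. Expressions such as $\mathrm E[Y^{\hat f}\mid W=w,\hat f]$ refer to a new draw $Y\sim P_w$ independent of $\hat f$. Put $\underline h=\min(h_1,h_0)$. **Assumptions.** (i) The scores are uniformly bounded: there is a constant $c$ with $|Y^{\hat f}_j|\le c$ a.s. for all $j$ and in both groups. (ii) The within-group variances are a.s. uniformly bounded away from zero: there is a constant $\varepsilon>0$ with $\operatorname{Var}(Y^{\hat f}\mid W=w,\hat f)\succeq\varepsilon I_k$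 a.s. for $w=0,1$. (iii) The themes are learned from the training data only: $\hat f\perp (Y_i,W_i)_{i\in\mathcal H}\mid (Y_i,W_i)_{i\in\mathcal T}$. **Claim.** Let $\tau=\mathrm E[Y^{\hat f}\mid W=1,\hat f]-\mathrm E[Y^{\hat f}\mid W=0,\hat f]$ and $$\hat\tau=\frac1{h_1}\sum_{i\in\mathcal H,\,W_i=1}Y_i^{\hat f}-\frac1{h_0}\sum_{i\in\mathcal H,\,W_i=0}Y_i^{\hat f}.$$ Then $\mathrm E[\hat\tau\mid\hat f]=\tau$ a.s. Moreover, along any family of such experiments, with the same $k$, $c$ and $\varepsilon$, in which $\underline h\to\infty$, $$\sup_{t\in\mathbb R^k}\left|\mathrm P\left(\sqrt{\underline h}\,(\hat\tau-\tau)\le t\,\middle|\,\hat f\right)-\mathrm P\left(\mathcal N(0_k,\Sigma)\le t\,\middle|\,\hat f\right)\right|\;\xrightarrow{\;p\;}\;0,$$ where $\le$ is coordinatewise and $$\Sigma=\frac{\underline h}{h_1}\operatorname{Var}(Y^{\hat f}\mid W=1,\hat f)+\frac{\underline h}{h_0}\operatorname{Var}(Y^{\hat f}\mid W=0,\hat f).$$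 -/

import Mathlib

open MeasureTheory ProbabilityTheory Filter Topology

noncomputable section

namespace TextThemes

/-- The random elements `X` and `Z` are conditionally independent given the random element `T`:
`P(X ∈ A, Z ∈ B | T) = P(X ∈ A | T) P(Z ∈ B | T)` almost surely, for all measurable `A`, `B`.
(No regularity of the underlying probability space is required.) -/
def CondIndepGiven {Ω α β γ : Type*} [MeasurableSpace Ω] [MeasurableSpace α] [MeasurableSpace β]
    [mγ : MeasurableSpace γ] (X : Ω → α) (Z : Ω → β) (T : Ω → γ) (μ : Measure Ω) : Prop :=
  ∀ A B, MeasurableSet A → MeasurableSet B →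
    μ⟦X ⁻¹' A ∩ Z ⁻¹' B | mγ.comap T⟧
      =ᵐ[μ] μ⟦X ⁻¹' A | mγ.comap T⟧ * μ⟦Z ⁻¹' B | mγ.comap T⟧

/-- The data `(Y i, W i)` of the units in the index set `S`, as one random element. -/
def dataOn {Ω 𝒴 : Type*} {n : ℕ} (Y : Fin n → Ω → 𝒴) (W : Fin n → Ω → Bool)
    (S : Finset (Fin n)) (ω : Ω) : S → 𝒴 × Bool :=
  fun i => (Y i ω, W i ω)

/-- Two independent iid samples of documents, together with a hold-out set `H` (whose complement is
the training set). `W i` is the group of unit `i` (`true` is treatment, `false` is control), `Y i`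
its document, and `P w` is the population distribution of `Y` given `W = w`. The group sizes
`n₁, n₀` and the split are held fixed; which units belong to which group may be random. -/
structure IsSplitSample {Ω 𝒴 : Type*} [MeasurableSpace Ω] [MeasurableSpace 𝒴] {n : ℕ}
    (μ : Measure Ω) (P : Bool → Measure 𝒴) (Y : Fin n → Ω → 𝒴) (W : Fin n → Ω → Bool)
    (n₁ n₀ h₁ h₀ : ℕ) (H : Finset (Fin n)) : Prop where
  measurable_Y : ∀ i, Measurable (Y i)
  measurable_W : ∀ i, Measurable (W i)
  /-- Given the group labels, the documents are independent and `Y i` has law `P (W i)`. -/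
  sampling : ∀ (w : Fin n → Bool) (B : Set (Fin n → 𝒴)), MeasurableSet B →
    μ ({ω | (fun i => W i ω) = w} ∩ {ω | (fun i => Y i ω) ∈ B})
      = μ {ω | (fun i => W i ω) = w} * Measure.pi (fun i => P (w i)) B
  card_treated : ∀ᵐ ω ∂μ, (Finset.univ.filter fun i => W i ω = true).card = n₁
  card_control : ∀ᵐ ω ∂μ, (Finset.univ.filter fun i => W i ω = false).card = n₀
  card_holdout_treated : ∀ᵐ ω ∂μ, (H.filter fun i => W i ω = true).card = h₁
  card_holdout_control : ∀ᵐ ω ∂μ, (H.filter fun i => W i ω = false).card = h₀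
  pos_treated : 0 < h₁
  lt_treated : h₁ < n₁
  pos_control : 0 < h₀
  lt_control : h₀ < n₀

section Scores

variable {Ω 𝒴 Θ : Type*} [MeasurableSpace 𝒴] {k : ℕ}

/-- `E[f(Y) | W = 1] - E[f(Y) | W = 0]` for the scoring function `f = score θ` of the themes `θ`. -/
def effect (score : Θ → 𝒴 → EuclideanSpace ℝ (Fin k)) (P : Bool → Measure 𝒴) (θ : Θ) :
    EuclideanSpace ℝ (Fin k) :=
  (∫ y, score θ y ∂(P true)) - ∫ y, score θ y ∂(P false)

/-- The covariance matrix `Var(f(Y) | W = w)` for the scoring function `f = score θ`. -/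
def groupVar (score : Θ → 𝒴 → EuclideanSpace ℝ (Fin k)) (P : Bool → Measure 𝒴) (w : Bool)
    (θ : Θ) : Matrix (Fin k) (Fin k) ℝ :=
  Matrix.of fun a b => cov[fun y => score θ y a, fun y => score θ y b; P w]

/-- The difference in mean scores between the treated and the control hold-out units. -/
def diffInMeans {n : ℕ} (score : Θ → 𝒴 → EuclideanSpace ℝ (Fin k)) (Y : Fin n → Ω → 𝒴)
    (W : Fin n → Ω → Bool) (h₁ h₀ : ℕ) (H : Finset (Fin n)) (fhat : Ω → Θ) (ω : Ω) :
    EuclideanSpace ℝ (Fin k) :=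
  (1 / (h₁ : ℝ)) • ∑ i ∈ H.filter (fun i => W i ω = true), score (fhat ω) (Y i ω)
    - (1 / (h₀ : ℝ)) • ∑ i ∈ H.filter (fun i => W i ω = false), score (fhat ω) (Y i ω)

/-- `Σ = (h̲ / h₁) Var(f(Y) | W = 1) + (h̲ / h₀) Var(f(Y) | W = 0)`, where `h̲ = min h₁ h₀`. -/
def asympVar (score : Θ → 𝒴 → EuclideanSpace ℝ (Fin k)) (P : Bool → Measure 𝒴) (h₁ h₀ : ℕ)
    (θ : Θ) : Matrix (Fin k) (Fin k) ℝ :=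
  ((min h₁ h₀ : ℕ) / (h₁ : ℝ)) • groupVar score P true θ
    + ((min h₁ h₀ : ℕ) / (h₀ : ℝ)) • groupVar score P false θ

end Scores

/-- The lower orthant `{x | x ≤ t}` of `ℝᵏ` (coordinatewise order). -/
def orthant {k : ℕ} (t : EuclideanSpace ℝ (Fin k)) : Set (EuclideanSpace ℝ (Fin k)) :=
  {x | ∀ j, x j ≤ t j}

/-- The uniform distance `sup_t |ν(x ≤ t) - ρ(x ≤ t)|` between the distribution functions of two
probability measures on `ℝᵏ`. -/
def cdfDist {k : ℕ} (ν ρ : Measure (EuclideanSpace ℝ (Fin k))) : ℝ :=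
  ⨆ t : EuclideanSpace ℝ (Fin k), |ν.real (orthant t) - ρ.real (orthant t)|

end TextThemes

end

/-! The theorem rests on two facts.

*The conditional law of the error.* The themes `fhat` are independent of the hold-out data given the
training data, and, given all labels, the hold-out documents are independent of the training
documents. Hence on each event fixing the hold-out labels, `fhat` and the hold-out documents are
independent, the latter with the product law of the `P (w i)`
(`IsSplitSample.map_themes_docs_restrict`). For fixed themes, the law of the centred difference in
means is the same for all labellings with the right group sizes, since its characteristic function
is a product of one power per group. So this law, evaluated at `fhat`, is a version of the
conditional distribution given `fhat` (`IsSplitSample.condDistrib_scaledError`). It is centred and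
boundedly supported, which gives integrability and unbiasedness.

*A uniform central limit theorem* (`exists_forall_cdfDist_le`). For laws with the given bound and
the given lower bound on the variance, the distance between the distribution function of the
normalized difference in means and that of the Gaussian is small as soon as both groups are large,
with no further dependence on the laws or the group sizes. Otherwise there is a sequence of
counterexamples, along which one may assume that the covariance matrices converge to some `T`, and
that the corners `t` at which the distribution functions differ converge in the extended reals. A
second-order expansion of the characteristic functions (`norm_charFun_mul_sub_le`) and Lévy's
theorem show that both laws converge weakly to the centred Gaussian with covariance `T`. This
Gaussian has nondegenerate coordinates, so both distribution functions at the moving corners have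
the same limit (`tendsto_measureReal_orthant`), a contradiction.

By uniformity, once the groups are large enough, the distance in the theorem is below `δ` almost
surely, so the probabilities in question are eventually zero, along any filter.
-/

noncomputable section

namespace TextThemes

open scoped Matrix

/-! ### Distribution functions under weak convergence -/

section Orthants

variable {k : ℕ}

/-- The orthant `{x | x ≤ t}` with a corner `t` whose coordinates may be infinite. -/
def extOrthant (t : Fin k → EReal) : Set (EuclideanSpace ℝ (Fin k)) :=
  {x | ∀ j, (x j : EReal) ≤ t j}

lemma extOrthant_coe (t : EuclideanSpace ℝ (Fin k)) :
    extOrthant (fun j => (t j : EReal)) = orthant t := by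
  ext x; simp [extOrthant, orthant]

/-- Distribution functions converge along convergent corners, also when corners escape to infinity:
the pair (random vector, corner) converges weakly to a limit that does not charge the boundary of
the closed set `{(x, t) | x ≤ t}`. -/
lemma tendsto_measureReal_orthant {ν : ℕ → ProbabilityMeasure (EuclideanSpace ℝ (Fin k))}
    {ρ : ProbabilityMeasure (EuclideanSpace ℝ (Fin k))} (hν : Tendsto ν atTop (𝓝 ρ))
    (hρ : ∀ j a, (ρ : Measure (EuclideanSpace ℝ (Fin k))) {x | x j = a} = 0)
    {t : ℕ → EuclideanSpace ℝ (Fin k)} {s : Fin k → EReal}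
    (ht : Tendsto (fun m j => (t m j : EReal)) atTop (𝓝 s)) :
    Tendsto (fun m => (ν m : Measure (EuclideanSpace ℝ (Fin k))).real (orthant (t m))) atTop
      (𝓝 ((ρ : Measure (EuclideanSpace ℝ (Fin k))).real (extOrthant s))) := by
  let C : Set (EuclideanSpace ℝ (Fin k) × (Fin k → EReal)) := {p | ∀ j, (p.1 j : EReal) ≤ p.2 j}
  have hcont1 : ∀ j, Continuous fun p : EuclideanSpace ℝ (Fin k) × (Fin k → EReal) =>
      ((p.1 j : ℝ) : EReal) := fun j => continuous_coe_real_ereal.comp (by fun_prop)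
  have hcont2 : ∀ j, Continuous fun p : EuclideanSpace ℝ (Fin k) × (Fin k → EReal) => p.2 j :=
    fun j => by fun_prop
  have hC : IsClosed C := by
    simp only [C, Set.ofPred_forall]
    exact isClosed_iInter fun j => isClosed_le (hcont1 j) (hcont2 j)
  have hfr : frontier C ⊆ ⋃ j, {p | (p.1 j : EReal) = p.2 j} := by
    intro p hp
    rw [hC.frontier_eq] at hp
    by_contra hne
    simp only [Set.mem_iUnion, Set.mem_ofPred_eq, not_exists] at hne
    refine hp.2 (mem_interior.2 ⟨{p | ∀ j, (p.1 j : EReal) < p.2 j}, fun q hq j => (hq j).le, ?_,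
      fun j => lt_of_le_of_ne (hp.1 j) (hne j)⟩)
    simp only [Set.ofPred_forall]
    exact isOpen_iInter_of_finite fun j => isOpen_lt (hcont1 j) (hcont2 j)
  have hprod (π : ProbabilityMeasure (EuclideanSpace ℝ (Fin k))) (r : Fin k → EReal) :
      ((π.prod (diracProba r) : ProbabilityMeasure _) : Measure _) C
        = (π : Measure (EuclideanSpace ℝ (Fin k))) (extOrthant r) := by
    rw [ProbabilityMeasure.toMeasure_prod, Measure.prod_apply_symm hC.measurableSet]
    simp only [diracProba, ProbabilityMeasure.coe_mk]
    rw [lintegral_dirac' _ (measurable_measure_prodMk_right hC.measurableSet)]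
    rfl
  have hlim : Tendsto (fun m => (ν m).prod (diracProba fun j => (t m j : EReal))) atTop
      (𝓝 (ρ.prod (diracProba s))) :=
    (ProbabilityMeasure.continuous_prod.tendsto (ρ, diracProba s)).comp
      (hν.prodMk_nhds ((continuous_diracProba.tendsto s).comp ht))
  have hnull : ((ρ.prod (diracProba s) : ProbabilityMeasure _) : Measure _) (frontier C) = 0 := by
    refine measure_mono_null hfr (measure_iUnion_null fun j => ?_)
    have hm : MeasurableSet {p : EuclideanSpace ℝ (Fin k) × (Fin k → EReal) |
        (p.1 j : EReal) = p.2 j} := (isClosed_eq (hcont1 j) (hcont2 j)).measurableSet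
    rw [ProbabilityMeasure.toMeasure_prod, Measure.prod_apply_symm hm]
    simp only [diracProba, ProbabilityMeasure.coe_mk]
    rw [lintegral_dirac' _ (measurable_measure_prodMk_right hm)]
    refine measure_mono_null ?_ (hρ j (s j).toReal)
    intro x hx
    have : ((x j : ℝ) : EReal) = s j := hx
    simp [← this]
  have key := ProbabilityMeasure.tendsto_measure_of_null_frontier_of_tendsto' hlim hnull
  simp only [hprod, extOrthant_coe] at key
  exact (ENNReal.tendsto_toReal (measure_ne_top _ _)).comp key

end Orthants

/-! ### Characteristic functions of bounded centred laws -/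

section CharFun

variable {E : Type*} [NormedAddCommGroup E] [InnerProductSpace ℝ E] [MeasurableSpace E]
  [BorelSpace E] [SecondCountableTopology E]
  [CompleteSpace E]

/-- Second-order expansion of the characteristic function of a bounded centred law, matched with
that of the Gaussian of the same variance. -/
lemma norm_charFun_sub_exp_le {Q : Measure E} [IsProbabilityMeasure Q] {C : ℝ}
    (hC : ∀ᵐ x ∂Q, ‖x‖ ≤ C) (h0 : ∫ x, x ∂Q = 0) {s : E} (hs : C * ‖s‖ ≤ 1) :
    ‖charFun Q s - Complex.exp (-((∫ x, inner ℝ x s ^ 2 ∂Q : ℝ) : ℂ) / 2)‖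
      ≤ 2 * (C * ‖s‖) ^ 3 := by
  have hC0 : 0 ≤ C := by
    obtain ⟨x, hx⟩ := hC.exists
    exact (norm_nonneg x).trans hx
  have hb : ∀ᵐ x ∂Q, |inner ℝ x s| ≤ C * ‖s‖ := hC.mono fun x hx =>
    (abs_real_inner_le_norm x s).trans (by gcongr)
  set v : ℝ := ∫ x, inner ℝ x s ^ 2 ∂Q with hv
  have hv0 : 0 ≤ v := integral_nonneg fun x => sq_nonneg _
  have hvle : v ≤ (C * ‖s‖) ^ 2 := by
    have := norm_integral_le_of_norm_le_const (μ := Q) (f := fun x => inner ℝ x s ^ 2)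
      (C := (C * ‖s‖) ^ 2) (hb.mono fun x hx => by
        rw [norm_pow, Real.norm_eq_abs]; gcongr)
    simpa [← hv, abs_of_nonneg hv0] using this
  have hCs : 0 ≤ C * ‖s‖ := by positivity
  have hint : Integrable (fun x : E => x) Q :=
    Integrable.of_bound aestronglyMeasurable_id C hC
  have hi1 : Integrable (fun x => (inner ℝ x s : ℝ)) Q := hint.inner_const s
  have hi2 : Integrable (fun x => (inner ℝ x s : ℝ) ^ 2) Q :=
    Integrable.of_bound (by fun_prop) ((C * ‖s‖) ^ 2) (hb.mono fun x hx => by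
        rw [norm_pow, Real.norm_eq_abs]; gcongr)
  have hi3 : Integrable (fun x => Complex.exp (inner ℝ x s * Complex.I)) Q :=
    Integrable.of_bound (by fun_prop) 1 (ae_of_all _ fun x => by
      rw [Complex.norm_exp_ofReal_mul_I])
  have hm1 : ∫ x, (inner ℝ x s : ℝ) ∂Q = 0 := by
    have h : ∀ x : E, (inner ℝ x s : ℝ) = inner ℝ s x := fun x => real_inner_comm _ _
    simp_rw [h]
    rw [integral_inner hint, h0, inner_zero_right]
  have htaylor : ∫ x, (1 + (inner ℝ x s : ℝ) * Complex.I - ((inner ℝ x s ^ 2 : ℝ) : ℂ) / 2) ∂Q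
      = 1 - v / 2 := by
    have e1 : Integrable (fun x => ((inner ℝ x s : ℝ) : ℂ) * Complex.I) Q :=
      hi1.ofReal.mul_const _
    have e2 : Integrable (fun x => ((inner ℝ x s ^ 2 : ℝ) : ℂ) / 2) Q := hi2.ofReal.div_const _
    rw [integral_sub (by exact (integrable_const _).add e1) e2,
      integral_add (integrable_const _) e1, integral_mul_const, integral_div,
      integral_complex_ofReal, integral_complex_ofReal, hm1, ← hv]
    simp
  have h1 : ‖charFun Q s - (1 - v / 2)‖ ≤ (C * ‖s‖) ^ 3 := by
    rw [charFun_apply, ← htaylor, ← integral_sub hi3 (by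
      exact (((integrable_const _).add (hi1.ofReal.mul_const _)).sub (hi2.ofReal.div_const _)))]
    refine (norm_integral_le_of_norm_le_const (C := (C * ‖s‖) ^ 3) (hb.mono fun x hx => ?_)).trans
      (by simp)
    have hn : ‖((inner ℝ x s : ℝ) : ℂ) * Complex.I‖ = |inner ℝ x s| := by simp
    have := Complex.exp_bound (x := ((inner ℝ x s : ℝ) : ℂ) * Complex.I)
      (by rw [hn]; exact hx.trans hs) (n := 3) (by norm_num)
    rw [hn] at this
    have hsum : ∑ m ∈ Finset.range 3, (((inner ℝ x s : ℝ) : ℂ) * Complex.I) ^ m / (m.factorial : ℂ)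
        = 1 + (inner ℝ x s : ℝ) * Complex.I - ((inner ℝ x s ^ 2 : ℝ) : ℂ) / 2 := by
      simp [Finset.sum_range_succ, mul_pow]
      ring
    rw [hsum] at this
    refine this.trans ?_
    calc _ ≤ |inner ℝ x s| ^ 3 * 1 := by
          gcongr; norm_num [Nat.factorial]
      _ ≤ _ := by rw [mul_one]; gcongr
  have h2 : ‖Complex.exp (-(v : ℂ) / 2) - (1 - v / 2)‖ ≤ (C * ‖s‖) ^ 3 := by
    have hn : ‖-(v : ℂ) / 2‖ = v / 2 := by
      rw [norm_div, norm_neg, Complex.norm_real, Real.norm_of_nonneg hv0]; simp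
    have hv1 : v ≤ 1 := hvle.trans (pow_le_one₀ hCs hs)
    have := Complex.norm_exp_sub_one_sub_id_le (x := -(v : ℂ) / 2) (by rw [hn]; linarith)
    rw [hn] at this
    calc _ = ‖Complex.exp (-(v : ℂ) / 2) - 1 - -(v : ℂ) / 2‖ := by congr 1; ring
      _ ≤ (v / 2) ^ 2 := this
      _ ≤ ((C * ‖s‖) ^ 2) ^ 2 := by gcongr; linarith
      _ = (C * ‖s‖) ^ 3 * (C * ‖s‖) := by ring
      _ ≤ (C * ‖s‖) ^ 3 := mul_le_of_le_one_right (by positivity) hs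
  calc _ = ‖(charFun Q s - (1 - v / 2)) - (Complex.exp (-(v : ℂ) / 2) - (1 - v / 2))‖ := by
        congr 1; ring
    _ ≤ _ := norm_sub_le _ _
    _ ≤ _ := by linarith

/-- Telescoping for powers of two numbers of the unit disc. -/
lemma norm_pow_sub_pow_le {z w : ℂ} (hz : ‖z‖ ≤ 1) (hw : ‖w‖ ≤ 1) (m : ℕ) :
    ‖z ^ m - w ^ m‖ ≤ m * ‖z - w‖ := by
  induction m with
  | zero => simp
  | succ m ih =>
    calc ‖z ^ (m + 1) - w ^ (m + 1)‖ = ‖z ^ m * (z - w) + (z ^ m - w ^ m) * w‖ := by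
          congr 1; ring
      _ ≤ ‖z ^ m * (z - w)‖ + ‖(z ^ m - w ^ m) * w‖ := norm_add_le _ _
      _ ≤ 1 * ‖z - w‖ + (m * ‖z - w‖) * 1 := by
          rw [norm_mul, norm_mul, norm_pow]
          gcongr
          exact pow_le_one₀ (norm_nonneg _) hz
      _ = _ := by push_cast; ring

/-- One group's factor in the characteristic function of a standardized difference in means:
`m` is the smaller and `h` the actual group size. -/
lemma norm_charFun_pow_sub_exp_le {Q : Measure E} [IsProbabilityMeasure Q] {C : ℝ}
    (hC : ∀ᵐ x ∂Q, ‖x‖ ≤ C) (h0 : ∫ x, x ∂Q = 0) {m h : ℕ} (hm : 0 < m) (hmh : m ≤ h) {r : ℝ}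
    (hr : |r| = √m / h) {u : E} (hu : C * ‖u‖ ≤ √m) :
    ‖charFun Q (r • u) ^ h
        - Complex.exp (-((m / h * ∫ x, inner ℝ x u ^ 2 ∂Q : ℝ) : ℂ) / 2)‖
      ≤ 2 * (C * ‖u‖) ^ 3 / √m := by
  have hC0 : 0 ≤ C := by
    obtain ⟨x, hx⟩ := hC.exists
    exact (norm_nonneg x).trans hx
  have hmR : (0 : ℝ) < m := by exact_mod_cast hm
  have hhR : (0 : ℝ) < h := by exact_mod_cast hm.trans_le hmh
  have hmhR : (m : ℝ) ≤ h := by exact_mod_cast hmh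
  have hsq : 0 < √(m : ℝ) := Real.sqrt_pos.2 hmR
  have hsqm : √(m : ℝ) * √m = m := Real.mul_self_sqrt hmR.le
  have hrle : |r| ≤ 1 / √m := by
    rw [hr, div_le_div_iff₀ hhR hsq, hsqm, one_mul]; exact hmhR
  have hCr : C * ‖r • u‖ = |r| * (C * ‖u‖) := by rw [norm_smul, Real.norm_eq_abs]; ring
  have hCr1 : C * ‖r • u‖ ≤ 1 := by
    rw [hCr]
    calc _ ≤ 1 / √m * √m := by gcongr
      _ = 1 := by field_simp
  have hv : ∫ x, inner ℝ x (r • u) ^ 2 ∂Q = r ^ 2 * ∫ x, inner ℝ x u ^ 2 ∂Q := by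
    rw [← integral_const_mul]
    congr with x
    rw [inner_smul_right]; ring
  have hr2 : h * r ^ 2 = m / h := by
    rw [← sq_abs, hr, div_pow, Real.sq_sqrt hmR.le]; field_simp
  have hexp : Complex.exp (-((m / h * ∫ x, inner ℝ x u ^ 2 ∂Q : ℝ) : ℂ) / 2)
      = Complex.exp (-((∫ x, inner ℝ x (r • u) ^ 2 ∂Q : ℝ) : ℂ) / 2) ^ h := by
    rw [← Complex.exp_nat_mul, hv, ← hr2]
    congr 1
    push_cast
    ring
  have hn : ‖Complex.exp (-((∫ x, inner ℝ x (r • u) ^ 2 ∂Q : ℝ) : ℂ) / 2)‖ ≤ 1 := by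
    have hv0 : 0 ≤ ∫ x, inner ℝ x (r • u) ^ 2 ∂Q := integral_nonneg fun x => sq_nonneg _
    rw [Complex.norm_exp, Real.exp_le_one_iff]
    have : (-((∫ x, inner ℝ x (r • u) ^ 2 ∂Q : ℝ) : ℂ) / 2)
        = ((-(∫ x, inner ℝ x (r • u) ^ 2 ∂Q) / 2 : ℝ) : ℂ) := by push_cast; ring
    rw [this, Complex.ofReal_re]
    linarith
  rw [hexp]
  calc _ ≤ h * ‖charFun Q (r • u)
          - Complex.exp (-((∫ x, inner ℝ x (r • u) ^ 2 ∂Q : ℝ) : ℂ) / 2)‖ :=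
        norm_pow_sub_pow_le (norm_charFun_le_one _) hn h
    _ ≤ h * (2 * (C * ‖r • u‖) ^ 3) := by
        gcongr
        exact norm_charFun_sub_exp_le hC h0 hCr1
    _ = (h * r ^ 2) * |r| * (2 * (C * ‖u‖) ^ 3) := by
        rw [hCr, mul_pow, pow_succ |r|, sq_abs]; ring
    _ ≤ 1 * (1 / √m) * (2 * (C * ‖u‖) ^ 3) := by
        rw [hr2]
        gcongr
        exact (div_le_one hhR).2 hmhR
    _ = _ := by ring

end CharFun

/-! ### Second moment matrices -/

section SecondMoment

variable {k : ℕ}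

/-- The matrix `E[x xᵀ]` of a law on `ℝᵏ`. -/
def secondMoment (Q : Measure (EuclideanSpace ℝ (Fin k))) : Matrix (Fin k) (Fin k) ℝ :=
  Matrix.of fun a b => ∫ x, x a * x b ∂Q

section Bounded

variable {Q : Measure (EuclideanSpace ℝ (Fin k))} {C : ℝ}

lemma abs_coord_mul_coord_le (hC : ∀ᵐ x ∂Q, ‖x‖ ≤ C) (a b : Fin k) :
    ∀ᵐ x ∂Q, ‖x a * x b‖ ≤ C ^ 2 := by
  filter_upwards [hC] with x hx
  rw [norm_mul, sq]
  exact mul_le_mul ((PiLp.norm_apply_le x a).trans hx) ((PiLp.norm_apply_le x b).trans hx)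
    (norm_nonneg _) ((norm_nonneg x).trans hx)

variable [IsProbabilityMeasure Q]

lemma abs_secondMoment_le (hC : ∀ᵐ x ∂Q, ‖x‖ ≤ C) (a b : Fin k) :
    |secondMoment Q a b| ≤ C ^ 2 := by
  simpa [secondMoment] using norm_integral_le_of_norm_le_const (abs_coord_mul_coord_le hC a b)

lemma dotProduct_secondMoment_mulVec (hC : ∀ᵐ x ∂Q, ‖x‖ ≤ C) (u : EuclideanSpace ℝ (Fin k)) :
    (u : Fin k → ℝ) ⬝ᵥ secondMoment Q *ᵥ u = ∫ x, inner ℝ x u ^ 2 ∂Q := by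
  have hint : ∀ a b, Integrable (fun x : EuclideanSpace ℝ (Fin k) => u a * (x a * x b * u b)) Q :=
    fun a b => ((Integrable.of_bound (by fun_prop) _
      (abs_coord_mul_coord_le hC a b)).mul_const _).const_mul _
  have hexp : ∀ x : EuclideanSpace ℝ (Fin k),
      inner ℝ x u ^ 2 = ∑ a, ∑ b, u a * (x a * x b * u b) := by
    intro x
    rw [PiLp.inner_apply, sq, Finset.sum_mul_sum]
    refine Finset.sum_congr rfl fun a _ => Finset.sum_congr rfl fun b _ => ?_
    simp
    ring
  simp_rw [hexp]
  rw [integral_finsetSum _ fun a _ => integrable_finsetSum _ fun b _ => hint a b]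
  simp_rw [integral_finsetSum _ fun b _ => hint _ b, integral_const_mul, integral_mul_const]
  simp [dotProduct, Matrix.mulVec, secondMoment, Finset.mul_sum]

lemma posSemidef_secondMoment (hC : ∀ᵐ x ∂Q, ‖x‖ ≤ C) : (secondMoment Q).PosSemidef := by
  refine Matrix.PosSemidef.of_dotProduct_mulVec_nonneg ?_ fun u => ?_
  · ext a b
    simp [secondMoment, mul_comm]
  · have := dotProduct_secondMoment_mulVec hC (WithLp.toLp 2 u)
    simp only [star_trivial]
    rw [show u ⬝ᵥ secondMoment Q *ᵥ u = _ from this]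
    exact integral_nonneg fun x => sq_nonneg _

end Bounded

end SecondMoment

/-! ### A uniform central limit theorem for differences in means -/

section UniformCLT

variable {k : ℕ}

/-- The covariance matrix of `√m • (X̄₁ - X̄₀)`, where `m` is the smaller of the group sizes `h₁, h₀`
and `X̄₁, X̄₀` are the means of independent samples from the centred laws `Q₁, Q₀`. -/
def pooledMoment (Q : Bool → Measure (EuclideanSpace ℝ (Fin k))) (h₁ h₀ : ℕ) :
    Matrix (Fin k) (Fin k) ℝ :=
  ((min h₁ h₀ : ℕ) / (h₁ : ℝ)) • secondMoment (Q true)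
    + ((min h₁ h₀ : ℕ) / (h₀ : ℝ)) • secondMoment (Q false)

lemma weight_le_one {m h : ℕ} (hmh : m ≤ h) : (m : ℝ) / h ≤ 1 :=
  div_le_one_of_le₀ (by exact_mod_cast hmh) (Nat.cast_nonneg _)

section Moments

variable {Q : Bool → Measure (EuclideanSpace ℝ (Fin k))} [∀ w, IsProbabilityMeasure (Q w)]
  {C : ℝ} {h₁ h₀ : ℕ}

lemma posSemidef_pooledMoment (hC : ∀ w, ∀ᵐ x ∂Q w, ‖x‖ ≤ C) :
    (pooledMoment Q h₁ h₀).PosSemidef :=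
  ((posSemidef_secondMoment (hC true)).smul (by positivity)).add
    ((posSemidef_secondMoment (hC false)).smul (by positivity))

lemma abs_pooledMoment_le (hC : ∀ w, ∀ᵐ x ∂Q w, ‖x‖ ≤ C) (a b : Fin k) :
    |pooledMoment Q h₁ h₀ a b| ≤ 2 * C ^ 2 := by
  have key (h : ℕ) (hh : min h₁ h₀ ≤ h) (w : Bool) :
      |(min h₁ h₀ : ℕ) / (h : ℝ) * secondMoment (Q w) a b| ≤ C ^ 2 := by
    rw [abs_mul, abs_of_nonneg (by positivity)]
    calc _ ≤ 1 * C ^ 2 :=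
          mul_le_mul (weight_le_one hh) (abs_secondMoment_le (hC w) a b) (abs_nonneg _) zero_le_one
      _ = _ := one_mul _
  calc _ ≤ _ := abs_add_le _ _
    _ ≤ C ^ 2 + C ^ 2 := add_le_add (key h₁ (min_le_left _ _) true) (key h₀ (min_le_right _ _) false)
    _ = _ := by ring

/-- The variances stay away from zero because the smaller group has weight one. -/
lemma le_pooledMoment_diag {ε : ℝ} (hC : ∀ w, ∀ᵐ x ∂Q w, ‖x‖ ≤ C)
    (hε : ∀ w, (secondMoment (Q w) - ε • (1 : Matrix (Fin k) (Fin k) ℝ)).PosSemidef)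
    (h₁pos : 0 < h₁) (h₀pos : 0 < h₀) (a : Fin k) : ε ≤ pooledMoment Q h₁ h₀ a a := by
  have hd (w : Bool) : ε ≤ secondMoment (Q w) a a := by
    have := (hε w).diag_nonneg (i := a)
    simpa using this
  have hp (w : Bool) : 0 ≤ secondMoment (Q w) a a :=
    (posSemidef_secondMoment (hC w)).diag_nonneg
  have e : pooledMoment Q h₁ h₀ a a = (min h₁ h₀ : ℕ) / (h₁ : ℝ) * secondMoment (Q true) a a
    + (min h₁ h₀ : ℕ) / (h₀ : ℝ) * secondMoment (Q false) a a := rfl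
  rw [e]
  have n1 : (h₁ : ℝ) ≠ 0 := by positivity
  have n0 : (h₀ : ℝ) ≠ 0 := by positivity
  rcases le_total h₁ h₀ with h | h
  · rw [min_eq_left h, div_self n1, one_mul]
    exact (hd true).trans (le_add_of_nonneg_right (mul_nonneg (by positivity) (hp false)))
  · rw [min_eq_right h, div_self n0, one_mul]
    exact (hd false).trans (le_add_of_nonneg_left (mul_nonneg (by positivity) (hp true)))

/-- Rate of convergence of the characteristic functions in the central limit theorem for a
difference in means of bounded samples. -/
lemma norm_charFun_mul_sub_le (hC : ∀ w, ∀ᵐ x ∂Q w, ‖x‖ ≤ C) (h0 : ∀ w, ∫ x, x ∂Q w = 0)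
    (hm : 0 < min h₁ h₀) {u : EuclideanSpace ℝ (Fin k)}
    (hu : C * ‖u‖ ≤ √(min h₁ h₀ : ℕ)) :
    ‖charFun (Q true) ((√(min h₁ h₀ : ℕ) / h₁ : ℝ) • u) ^ h₁
        * charFun (Q false) (-(√(min h₁ h₀ : ℕ) / h₀ : ℝ) • u) ^ h₀
      - charFun (multivariateGaussian 0 (pooledMoment Q h₁ h₀)) u‖
      ≤ 4 * (C * ‖u‖) ^ 3 / √(min h₁ h₀ : ℕ) := by
  have hA := norm_charFun_pow_sub_exp_le (hC true) (h0 true) hm (min_le_left h₁ h₀)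
    (r := √(min h₁ h₀ : ℕ) / h₁) (abs_of_nonneg (by positivity)) hu
  have hB := norm_charFun_pow_sub_exp_le (hC false) (h0 false) hm (min_le_right h₁ h₀)
    (r := -(√(min h₁ h₀ : ℕ) / h₀)) (by rw [abs_neg, abs_of_nonneg (by positivity)]) hu
  have hG : charFun (multivariateGaussian 0 (pooledMoment Q h₁ h₀)) u
      = Complex.exp (-(((min h₁ h₀ : ℕ) / h₁ * ∫ x, inner ℝ x u ^ 2 ∂Q true : ℝ) : ℂ) / 2)
        * Complex.exp (-(((min h₁ h₀ : ℕ) / h₀ * ∫ x, inner ℝ x u ^ 2 ∂Q false : ℝ) : ℂ) / 2) := by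
    rw [charFun_multivariateGaussian (posSemidef_pooledMoment hC), ← Complex.exp_add,
      pooledMoment, Matrix.add_mulVec, dotProduct_add, Matrix.smul_mulVec, Matrix.smul_mulVec,
      dotProduct_smul, dotProduct_smul, dotProduct_secondMoment_mulVec (hC true),
      dotProduct_secondMoment_mulVec (hC false), inner_zero_right, smul_eq_mul, smul_eq_mul]
    congr 1
    push_cast
    ring
  have hn (z : ℝ) (hz : 0 ≤ z) : ‖Complex.exp (-(z : ℂ) / 2)‖ ≤ 1 := by
    rw [Complex.norm_exp, Real.exp_le_one_iff, show (-(z : ℂ) / 2) = ((-z / 2 : ℝ) : ℂ) by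
      push_cast; ring, Complex.ofReal_re]
    linarith
  rw [hG]
  set A := charFun (Q true) ((√(min h₁ h₀ : ℕ) / h₁ : ℝ) • u) ^ h₁
  set B := charFun (Q false) (-(√(min h₁ h₀ : ℕ) / h₀ : ℝ) • u) ^ h₀
  set A' := Complex.exp (-(((min h₁ h₀ : ℕ) / h₁ * ∫ x, inner ℝ x u ^ 2 ∂Q true : ℝ) : ℂ) / 2)
  set B' := Complex.exp (-(((min h₁ h₀ : ℕ) / h₀ * ∫ x, inner ℝ x u ^ 2 ∂Q false : ℝ) : ℂ) / 2)
  have hBn : ‖B‖ ≤ 1 := by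
    rw [norm_pow]; exact pow_le_one₀ (norm_nonneg _) (norm_charFun_le_one _)
  have hAn : ‖A'‖ ≤ 1 := hn _ (mul_nonneg (by positivity) (integral_nonneg fun x => sq_nonneg _))
  calc ‖A * B - A' * B'‖ = ‖(A - A') * B + A' * (B - B')‖ := by congr 1; ring
    _ ≤ ‖A - A'‖ * ‖B‖ + ‖A'‖ * ‖B - B'‖ := by
        rw [← norm_mul, ← norm_mul]; exact norm_add_le _ _
    _ ≤ ‖A - A'‖ * 1 + 1 * ‖B - B'‖ := by gcongr
    _ ≤ _ := by
        rw [mul_one, one_mul]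
        calc _ ≤ _ := add_le_add hA hB
          _ = _ := by ring

end Moments

lemma multivariateGaussian_coord_eq_zero {S : Matrix (Fin k) (Fin k) ℝ} (hS : S.PosSemidef)
    {j : Fin k} (hj : 0 < S j j) (a : ℝ) :
    multivariateGaussian 0 S {x | x j = a} = 0 := by
  have hmp := measurePreserving_eval_multivariateGaussian (μ := 0) hS (i := j)
  have : NullSingletonClass (gaussianReal ((0 : EuclideanSpace ℝ (Fin k)) j) (S j j).toNNReal) :=
    nullSingletonClass_gaussianReal (by simpa using hj)
  have h := hmp.measure_preimage (s := {a}) (measurableSet_singleton a).nullMeasurableSet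
  rw [measure_singleton] at h
  exact h

/-- A central limit theorem for differences in means that is uniform over the group sizes and over
the two laws, as long as these are bounded by `C` and have variance at least `ε`. A sequence of
counterexamples would have covariance matrices and corners that converge along a subsequence, and
both distribution functions would have the same limit there. -/
theorem exists_forall_cdfDist_le (k : ℕ) (C : ℝ) {ε η : ℝ} (hε : 0 < ε) (hη : 0 < η) :
    ∃ N : ℕ, ∀ (h₁ h₀ : ℕ), N ≤ min h₁ h₀ → 0 < min h₁ h₀ →
      ∀ (Q : Bool → Measure (EuclideanSpace ℝ (Fin k))) (L : Measure (EuclideanSpace ℝ (Fin k))),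
      (∀ w, IsProbabilityMeasure (Q w)) → IsProbabilityMeasure L →
      (∀ w, ∀ᵐ x ∂Q w, ‖x‖ ≤ C) → (∀ w, ∫ x, x ∂Q w = 0) →
      (∀ w, (secondMoment (Q w) - ε • (1 : Matrix (Fin k) (Fin k) ℝ)).PosSemidef) →
      (∀ u, charFun L u = charFun (Q true) ((√(min h₁ h₀ : ℕ) / h₁ : ℝ) • u) ^ h₁
        * charFun (Q false) (-(√(min h₁ h₀ : ℕ) / h₀ : ℝ) • u) ^ h₀) →
      cdfDist L (multivariateGaussian 0 (pooledMoment Q h₁ h₀)) ≤ η := by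
  by_contra! hcon
  choose h₁ h₀ hN hpos Q L hQ hL hC h0 hcov hchar hbad using hcon
  have ht : ∀ m, ∃ t : EuclideanSpace ℝ (Fin k), η < |(L m).real (orthant t)
      - (multivariateGaussian 0 (pooledMoment (Q m) (h₁ m) (h₀ m))).real (orthant t)| :=
    fun m => exists_lt_of_lt_ciSup (hbad m)
  choose t ht using ht
  set S : ℕ → Matrix (Fin k) (Fin k) ℝ := fun m => pooledMoment (Q m) (h₁ m) (h₀ m)
  have hSpos : ∀ m, (S m).PosSemidef := fun m => posSemidef_pooledMoment (hC m)
  let K : Set (Matrix (Fin k) (Fin k) ℝ) :=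
    Set.univ.pi fun _ => Set.univ.pi fun _ => Set.Icc (-(2 * C ^ 2)) (2 * C ^ 2)
  have hK : IsCompact K := isCompact_univ_pi fun _ => isCompact_univ_pi fun _ => isCompact_Icc
  have hSK : ∀ m, S m ∈ K := fun m a _ b _ => abs_le.1 (abs_pooledMoment_le (hC m) a b)
  -- Corners are taken in the compact space of extended reals, so that they may escape to infinity.
  have : FirstCountableTopology (Matrix (Fin k) (Fin k) ℝ) :=
    inferInstanceAs (FirstCountableTopology (Fin k → Fin k → ℝ))
  obtain ⟨⟨T, s⟩, -, φ, hφ, hlim⟩ := (hK.prod (isCompact_univ (X := Fin k → EReal))).tendsto_subseq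
    (x := fun m => (S m, fun j => (t m j : EReal))) fun m => ⟨hSK m, Set.mem_univ _⟩
  have hlimS : Tendsto (fun m => S (φ m)) atTop (𝓝 T) := hlim.fst_nhds
  have hlimt : Tendsto (fun m j => (t (φ m) j : EReal)) atTop (𝓝 s) := hlim.snd_nhds
  have hentry (a b : Fin k) : Tendsto (fun m => S (φ m) a b) atTop (𝓝 (T a b)) :=
    (tendsto_pi_nhds.1 ((tendsto_pi_nhds.1 hlimS) a)) b
  -- Entrywise limits preserve positive semidefiniteness and the lower bound on the diagonal.
  have hquad (u : Fin k → ℝ) :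
      Tendsto (fun m => u ⬝ᵥ S (φ m) *ᵥ u) atTop (𝓝 (u ⬝ᵥ T *ᵥ u)) := by
    simp only [dotProduct, Matrix.mulVec]
    exact tendsto_finsetSum _ fun a _ => (tendsto_finsetSum _ fun b _ =>
      (hentry a b).mul_const _).const_mul _
  have hT : T.PosSemidef := by
    refine Matrix.PosSemidef.of_dotProduct_mulVec_nonneg ?_ fun u => ?_
    · ext a b
      refine tendsto_nhds_unique (hentry b a) ((hentry a b).congr fun m => ?_)
      exact (hSpos (φ m)).1.apply b a
    · exact ge_of_tendsto' (hquad u) fun m => (hSpos (φ m)).dotProduct_mulVec_nonneg u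
  have hTdiag (a : Fin k) : 0 < T a a := hε.trans_le (ge_of_tendsto' (hentry a a) fun m =>
    le_pooledMoment_diag (hC _) (hcov _) ((hpos _).trans_le (min_le_left _ _))
      ((hpos _).trans_le (min_le_right _ _)) a)
  have hsize : Tendsto (fun m => √((min (h₁ (φ m)) (h₀ (φ m)) : ℕ) : ℝ)) atTop atTop :=
    Real.tendsto_sqrt_atTop.comp (tendsto_natCast_atTop_atTop.comp
      (tendsto_atTop_mono (fun m => hN (φ m)) hφ.tendsto_atTop))
  let ρ : ProbabilityMeasure (EuclideanSpace ℝ (Fin k)) := ⟨multivariateGaussian 0 T, inferInstance⟩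
  let G : ℕ → ProbabilityMeasure (EuclideanSpace ℝ (Fin k)) :=
    fun m => ⟨multivariateGaussian 0 (S (φ m)), inferInstance⟩
  let ν : ℕ → ProbabilityMeasure (EuclideanSpace ℝ (Fin k)) := fun m => ⟨L (φ m), hL _⟩
  have hcharG (u : EuclideanSpace ℝ (Fin k)) :
      Tendsto (fun m => charFun (multivariateGaussian 0 (S (φ m))) u) atTop
        (𝓝 (charFun (multivariateGaussian 0 T) u)) := by
    simp only [charFun_multivariateGaussian (hSpos _), charFun_multivariateGaussian hT]
    exact (Complex.continuous_exp.tendsto _).comp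
      (tendsto_const_nhds.sub (((Complex.continuous_ofReal.tendsto _).comp (hquad u)).div_const _))
  have hG : Tendsto G atTop (𝓝 ρ) := ProbabilityMeasure.tendsto_of_tendsto_charFun hcharG
  have hν : Tendsto ν atTop (𝓝 ρ) := by
    refine ProbabilityMeasure.tendsto_of_tendsto_charFun fun u => ?_
    have hdiff : Tendsto (fun m => charFun (L (φ m)) u
        - charFun (multivariateGaussian 0 (S (φ m))) u) atTop (𝓝 0) := by
      refine squeeze_zero_norm' ?_ (hsize.const_div_atTop (4 * (C * ‖u‖) ^ 3))
      filter_upwards [hsize.eventually_ge_atTop (C * ‖u‖)] with m hm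
      rw [hchar]
      exact norm_charFun_mul_sub_le (hC _) (h0 _) (hpos _) hm
    have hsum := hdiff.add (hcharG u)
    simp only [sub_add_cancel, zero_add] at hsum
    exact hsum
  have hatom (j : Fin k) (a : ℝ) : (ρ : Measure (EuclideanSpace ℝ (Fin k))) {x | x j = a} = 0 :=
    multivariateGaussian_coord_eq_zero hT (hTdiag j) a
  -- Both distribution functions, at the moving corners, tend to that of `ρ` at the limit corner.
  have hzero := ((tendsto_measureReal_orthant hν hatom hlimt).sub
    (tendsto_measureReal_orthant hG hatom hlimt)).abs
  rw [sub_self, abs_zero] at hzero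
  exact absurd (ge_of_tendsto' hzero fun m => (ht (φ m)).le) (not_le.2 hη)

end UniformCLT

/-! ### The hold-out data given the themes -/

section Conditioning

variable {Ω 𝒴 Θ : Type*} [MeasurableSpace Ω] [MeasurableSpace 𝒴] [MeasurableSpace Θ] {n : ℕ}
  {μ : Measure Ω} {P : Bool → Measure 𝒴}
  {Y : Fin n → Ω → 𝒴} {W : Fin n → Ω → Bool} {n₁ n₀ h₁ h₀ : ℕ} {H : Finset (Fin n)}

lemma measure_eq_sum_inter_preimage_singleton {α : Type*} [MeasurableSpace α] [Fintype α]
    [MeasurableSingletonClass α] {V : Ω → α} (hV : Measurable V) (s : Set Ω) :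
    μ s = ∑ a, μ (s ∩ V ⁻¹' {a}) := by
  have h := sum_measure_preimage_singleton (μ := μ.restrict s) (f := V) Finset.univ
    fun a _ => hV (measurableSet_singleton a)
  simp only [Finset.coe_univ, Set.preimage_univ, Measure.restrict_apply_univ] at h
  rw [← h]
  exact Finset.sum_congr rfl fun a _ => by
    rw [Measure.restrict_apply (hV (measurableSet_singleton a)), Set.inter_comm]

/-- The group labels of the units in `S`. -/
def labelsOn (W : Fin n → Ω → Bool) (S : Finset (Fin n)) (ω : Ω) : S → Bool := fun i => W i ω

/-- The documents of the units in `S`. -/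
def docsOn (Y : Fin n → Ω → 𝒴) (S : Finset (Fin n)) (ω : Ω) : S → 𝒴 := fun i => Y i ω

/-- The data sets on `S` with group labels `w` and documents in `B`. -/
def labelledDocs {S : Finset (Fin n)} (w : S → Bool) (B : Set (S → 𝒴)) : Set (S → 𝒴 × Bool) :=
  {d | (fun i => (d i).2) = w ∧ (fun i => (d i).1) ∈ B}

lemma measurableSet_labelledDocs {S : Finset (Fin n)} (w : S → Bool) {B : Set (S → 𝒴)}
    (hB : MeasurableSet B) : MeasurableSet (labelledDocs w B) := by
  have h1 : Measurable fun d : S → 𝒴 × Bool => fun i => (d i).2 := by fun_prop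
  have h2 : Measurable fun d : S → 𝒴 × Bool => fun i => (d i).1 := by fun_prop
  exact (h1 (measurableSet_singleton w)).inter (h2 hB)

omit [MeasurableSpace Ω] [MeasurableSpace 𝒴] in
lemma preimage_labelledDocs {S : Finset (Fin n)} (w : S → Bool) (B : Set (S → 𝒴)) :
    dataOn Y W S ⁻¹' labelledDocs w B = labelsOn W S ⁻¹' {w} ∩ docsOn Y S ⁻¹' B := rfl

namespace IsSplitSample

variable (hs : IsSplitSample μ P Y W n₁ n₀ h₁ h₀ H)
include hs

lemma measurable_dataOn (S : Finset (Fin n)) : Measurable (dataOn Y W S) :=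
  measurable_pi_lambda _ fun i => (hs.measurable_Y i).prodMk (hs.measurable_W i)

lemma measurable_labelsOn (S : Finset (Fin n)) : Measurable (labelsOn W S) :=
  measurable_pi_lambda _ fun i => hs.measurable_W i

lemma measurable_docsOn (S : Finset (Fin n)) : Measurable (docsOn Y S) :=
  measurable_pi_lambda _ fun i => hs.measurable_Y i

lemma measurable_statistic {E : Type*} [MeasurableSpace E] {F : (H → Bool) → Θ × (H → 𝒴) → E}
    (hF : ∀ w, Measurable (F w)) {fhat : Ω → Θ} (hf : Measurable fhat) :
    Measurable fun ω => F (labelsOn W H ω) (fhat ω, docsOn Y H ω) := by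
  have hFm : Measurable fun p : (H → Bool) × (Θ × (H → 𝒴)) => F p.1 p.2 :=
    measurable_from_prod_countable_right hF
  exact hFm.comp ((hs.measurable_labelsOn H).prodMk (hf.prodMk (hs.measurable_docsOn H)))

variable [∀ w, IsProbabilityMeasure (P w)]

/-- Given all labels, the hold-out documents are independent of the training documents. -/
lemma measure_labels_inter_docs_inter (v : Fin n → Bool) {B : Set (H → 𝒴)} (hB : MeasurableSet B)
    {C : Set ((Hᶜ : Finset (Fin n)) → 𝒴 × Bool)} (hC : MeasurableSet C) :
    μ ({ω | (fun i => W i ω) = v} ∩ (docsOn Y H ⁻¹' B ∩ dataOn Y W Hᶜ ⁻¹' C))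
      = Measure.pi (fun i : H => P (v i)) B
        * μ ({ω | (fun i => W i ω) = v} ∩ dataOn Y W Hᶜ ⁻¹' C) := by
  let e := MeasurableEquiv.piEquivPiSubtypeProd (fun _ : Fin n => 𝒴) (· ∈ H)
  let C' : Set ({i // ¬ i ∈ H} → 𝒴) :=
    {z | (fun i : (Hᶜ : Finset (Fin n)) => (z ⟨i, Finset.mem_compl.1 i.2⟩, v i)) ∈ C}
  have hC' : MeasurableSet C' :=
    (measurable_pi_lambda _ fun i => (measurable_pi_apply _).prodMk measurable_const) hC
  have key (B : Set (H → 𝒴)) (hB : MeasurableSet B) :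
      μ ({ω | (fun i => W i ω) = v} ∩ (docsOn Y H ⁻¹' B ∩ dataOn Y W Hᶜ ⁻¹' C))
        = μ {ω | (fun i => W i ω) = v} * (Measure.pi (fun i : H => P (v i)) B
          * Measure.pi (fun i : {i // ¬ i ∈ H} => P (v i)) C') := by
    have hset : {ω | (fun i => W i ω) = v} ∩ (docsOn Y H ⁻¹' B ∩ dataOn Y W Hᶜ ⁻¹' C)
        = {ω | (fun i => W i ω) = v} ∩ {ω | (fun i => Y i ω) ∈ e ⁻¹' (B ×ˢ C')} := by
      ext ω
      refine and_congr_right fun hω => ?_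
      have hd : dataOn Y W Hᶜ ω = fun i : (Hᶜ : Finset (Fin n)) => (Y i ω, v i) :=
        funext fun i => Prod.ext rfl (congrFun hω i)
      change docsOn Y H ω ∈ B ∧ dataOn Y W Hᶜ ω ∈ C ↔ _
      rw [hd]
      rfl
    rw [hset, hs.sampling v _ (e.measurable (hB.prod hC'))]
    congr 1
    have hmp := measurePreserving_piEquivPiSubtypeProd (fun i => P (v i)) (· ∈ H)
    refine (hmp.measure_preimage (hB.prod hC').nullMeasurableSet).trans ?_
    convert! Measure.prod_prod (μ := Measure.pi fun i : H => P (v i))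
      (ν := Measure.pi fun i : {i // ¬ i ∈ H} => P (v i)) B C'
  -- The case `B = univ` identifies the factor that does not involve `B`.
  have huniv := key Set.univ MeasurableSet.univ
  rw [Set.preimage_univ, Set.univ_inter, measure_univ, one_mul] at huniv
  rw [key B hB, huniv]
  ring

/-- Given the training data and the hold-out labels, the hold-out documents are independent with
laws `P (w i)`. -/
lemma measure_labels_inter_docs_inter_training (w : H → Bool) {B : Set (H → 𝒴)}
    (hB : MeasurableSet B) {C : Set ((Hᶜ : Finset (Fin n)) → 𝒴 × Bool)} (hC : MeasurableSet C) :
    μ (labelsOn W H ⁻¹' {w} ∩ docsOn Y H ⁻¹' B ∩ dataOn Y W Hᶜ ⁻¹' C)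
      = Measure.pi (fun i => P (w i)) B * μ (labelsOn W H ⁻¹' {w} ∩ dataOn Y W Hᶜ ⁻¹' C) := by
  have hW : Measurable fun ω i => W i ω := measurable_pi_lambda _ hs.measurable_W
  rw [measure_eq_sum_inter_preimage_singleton hW,
    measure_eq_sum_inter_preimage_singleton hW (labelsOn W H ⁻¹' {w} ∩ _), Finset.mul_sum]
  refine Finset.sum_congr rfl fun v _ => ?_
  by_cases hv : (fun i : H => v i) = w
  · have hsub : (fun ω i => W i ω) ⁻¹' {v} ⊆ labelsOn W H ⁻¹' {w} := by
      intro ω hω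
      change (fun i : H => W i ω) = w
      rw [← hv]
      exact funext fun i => congrFun hω i
    have h1 : labelsOn W H ⁻¹' {w} ∩ docsOn Y H ⁻¹' B ∩ dataOn Y W Hᶜ ⁻¹' C
          ∩ (fun ω i => W i ω) ⁻¹' {v}
        = {ω | (fun i => W i ω) = v} ∩ (docsOn Y H ⁻¹' B ∩ dataOn Y W Hᶜ ⁻¹' C) := by
      ext ω
      exact ⟨fun h => ⟨h.2, h.1.1.2, h.1.2⟩, fun h => ⟨⟨⟨hsub h.1, h.2.1⟩, h.2.2⟩, h.1⟩⟩
    have h2 : labelsOn W H ⁻¹' {w} ∩ dataOn Y W Hᶜ ⁻¹' C ∩ (fun ω i => W i ω) ⁻¹' {v}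
        = {ω | (fun i => W i ω) = v} ∩ dataOn Y W Hᶜ ⁻¹' C := by
      ext ω
      exact ⟨fun h => ⟨h.2, h.1.2⟩, fun h => ⟨⟨hsub h.1, h.2⟩, h.1⟩⟩
    rw [h1, h2, hs.measure_labels_inter_docs_inter v hB hC, ← hv]
  · have hdisj : labelsOn W H ⁻¹' {w} ∩ (fun ω i => W i ω) ⁻¹' {v} = ∅ := by
      ext ω
      simp only [Set.mem_inter_iff, Set.mem_empty_iff_false, iff_false, not_and]
      intro h1 h2
      exact hv (funext fun i => (congrFun h2 i).symm.trans (congrFun h1 i))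
    have h0 : μ (labelsOn W H ⁻¹' {w} ∩ (fun ω i => W i ω) ⁻¹' {v}) = 0 := by
      rw [hdisj, measure_empty]
    rw [measure_mono_null (Set.inter_subset_inter_left _
        (Set.inter_subset_left.trans Set.inter_subset_left)) h0,
      measure_mono_null (Set.inter_subset_inter_left _ Set.inter_subset_left) h0, mul_zero]

variable [IsProbabilityMeasure μ]

/-- The conditional probability form of `measure_labels_inter_docs_inter_training`. -/
lemma condExp_labels_inter_docs (w : H → Bool) {B : Set (H → 𝒴)} (hB : MeasurableSet B) :
    μ⟦labelsOn W H ⁻¹' {w} ∩ docsOn Y H ⁻¹' B | MeasurableSpace.comap (dataOn Y W Hᶜ) inferInstance⟧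
      =ᵐ[μ] fun ω => (Measure.pi fun i => P (w i)).real B
        * (μ⟦labelsOn W H ⁻¹' {w} | MeasurableSpace.comap (dataOn Y W Hᶜ) inferInstance⟧) ω := by
  have hT := hs.measurable_dataOn Hᶜ
  have hlab : MeasurableSet (labelsOn W H ⁻¹' {w}) :=
    hs.measurable_labelsOn H (measurableSet_singleton w)
  have hdoc : MeasurableSet (docsOn Y H ⁻¹' B) := hs.measurable_docsOn H hB
  symm
  refine ae_eq_condExp_of_forall_setIntegral_eq hT.comap_le
    ((integrable_const 1).indicator (hlab.inter hdoc))
    (fun s _ _ => (integrable_condExp.const_mul _).integrableOn) ?_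
    (stronglyMeasurable_condExp.const_mul _).aestronglyMeasurable
  rintro _ ⟨C, hC, rfl⟩ -
  rw [integral_const_mul, setIntegral_condExp hT.comap_le ((integrable_const 1).indicator hlab)
    ⟨C, hC, rfl⟩, integral_indicator hlab, integral_indicator (hlab.inter hdoc),
    Measure.restrict_restrict hlab, Measure.restrict_restrict (hlab.inter hdoc)]
  simp only [integral_const, smul_eq_mul, mul_one, measureReal_restrict_apply_univ]
  simp only [measureReal_def]
  rw [hs.measure_labels_inter_docs_inter_training w hB hC, ENNReal.toReal_mul]

variable {fhat : Ω → Θ} (hf : Measurable fhat)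
  (hci : CondIndepGiven fhat (dataOn Y W H) (dataOn Y W Hᶜ) μ)
include hf hci

/-- Given the themes and the hold-out labels, the hold-out documents are still independent with laws
`P (w i)`: the themes bring in nothing but training data. -/
lemma measure_themes_inter_labels_inter_docs (w : H → Bool) {A : Set Θ} (hA : MeasurableSet A)
    {B : Set (H → 𝒴)} (hB : MeasurableSet B) :
    μ (fhat ⁻¹' A ∩ (labelsOn W H ⁻¹' {w} ∩ docsOn Y H ⁻¹' B))
      = μ (fhat ⁻¹' A ∩ labelsOn W H ⁻¹' {w}) * Measure.pi (fun i => P (w i)) B := by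
  have hT := hs.measurable_dataOn Hᶜ
  have hfac (B : Set (H → 𝒴)) (hB : MeasurableSet B) :
      μ.real (fhat ⁻¹' A ∩ (labelsOn W H ⁻¹' {w} ∩ docsOn Y H ⁻¹' B))
        = (Measure.pi fun i => P (w i)).real B
          * ∫ ω, (μ⟦fhat ⁻¹' A | MeasurableSpace.comap (dataOn Y W Hᶜ) inferInstance⟧) ω
            * (μ⟦labelsOn W H ⁻¹' {w} |
                MeasurableSpace.comap (dataOn Y W Hᶜ) inferInstance⟧) ω ∂μ := by
    have hdata : MeasurableSet (labelsOn W H ⁻¹' {w} ∩ docsOn Y H ⁻¹' B) :=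
      (hs.measurable_labelsOn H (measurableSet_singleton w)).inter (hs.measurable_docsOn H hB)
    rw [← integral_condExp_indicator hT ((hf hA).inter hdata), ← integral_const_mul]
    refine integral_congr_ae ?_
    have h := hci A (labelledDocs w B) hA (measurableSet_labelledDocs w hB)
    rw [preimage_labelledDocs] at h
    filter_upwards [h, hs.condExp_labels_inter_docs w hB] with ω h1 h2
    rw [h1, Pi.mul_apply, h2]
    ring
  -- The case `B = univ` identifies the integral on the right.
  have huniv := hfac Set.univ MeasurableSet.univ
  rw [Set.preimage_univ, Set.inter_univ, probReal_univ, one_mul] at huniv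
  have hB' := hfac B hB
  rw [← huniv, mul_comm] at hB'
  simp only [measureReal_def, ← ENNReal.toReal_mul] at hB'
  exact (ENNReal.toReal_eq_toReal_iff' (measure_ne_top _ _)
    (ENNReal.mul_ne_top (measure_ne_top _ _) (measure_ne_top _ _))).1 hB'

/-- On the event that the hold-out labels are `w`, themes and hold-out documents are independent. -/
lemma map_themes_docs_restrict (w : H → Bool) :
    (μ.restrict (labelsOn W H ⁻¹' {w})).map (fun ω => (fhat ω, docsOn Y H ω))
      = ((μ.restrict (labelsOn W H ⁻¹' {w})).map fhat).prod (Measure.pi fun i => P (w i)) := by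
  symm
  refine Measure.prod_eq fun A B hA hB => ?_
  rw [Measure.map_apply (hf.prodMk (hs.measurable_docsOn H)) (hA.prod hB),
    Measure.map_apply hf hA, Measure.restrict_apply (hf hA),
    Measure.restrict_apply ((hf.prodMk (hs.measurable_docsOn H)) (hA.prod hB)),
    ← hs.measure_themes_inter_labels_inter_docs hf hci w hA hB]
  congr 1
  ext ω
  simp only [Set.mem_inter_iff, Set.mem_preimage, Set.mem_prod]
  tauto

/-- A statistic of the themes and the hold-out data whose law, for fixed themes, does not depend on
the hold-out labels has that law as its conditional distribution given the themes. -/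
lemma condDistrib_ae_eq {E : Type*} [MeasurableSpace E] [StandardBorelSpace E] [Nonempty E]
    {F : (H → Bool) → Θ × (H → 𝒴) → E} (hF : ∀ w, Measurable (F w))
    {κ : Kernel Θ E} [IsFiniteKernel κ]
    (hκ : ∀ w, μ (labelsOn W H ⁻¹' {w}) ≠ 0 → ∀ θ,
      (Measure.pi fun i => P (w i)).map (fun y => F w (θ, y)) = κ θ) :
    ∀ᵐ ω ∂μ, condDistrib (fun ω => F (labelsOn W H ω) (fhat ω, docsOn Y H ω)) fhat μ (fhat ω)
      = κ (fhat ω) := by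
  have hlab := hs.measurable_labelsOn H
  have hdoc := hs.measurable_docsOn H
  have hS := hs.measurable_statistic hF hf
  refine ae_of_ae_map hf.aemeasurable
    (condDistrib_ae_eq_of_measure_eq_compProd fhat hS.aemeasurable ?_)
  have hpiece (w : H → Bool) :
      (μ.restrict (labelsOn W H ⁻¹' {w})).map
          (fun ω => (fhat ω, F (labelsOn W H ω) (fhat ω, docsOn Y H ω)))
        = (μ.restrict (labelsOn W H ⁻¹' {w})).map fhat ⊗ₘ κ := by
    by_cases h0 : μ (labelsOn W H ⁻¹' {w}) = 0
    · rw [Measure.restrict_eq_zero.2 h0]; simp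
    have hcongr : (μ.restrict (labelsOn W H ⁻¹' {w})).map
          (fun ω => (fhat ω, F (labelsOn W H ω) (fhat ω, docsOn Y H ω)))
        = ((μ.restrict (labelsOn W H ⁻¹' {w})).map (fun ω => (fhat ω, docsOn Y H ω))).map
          (fun p => (p.1, F w p)) := by
      rw [Measure.map_map (measurable_fst.prodMk (hF w)) (hf.prodMk hdoc)]
      refine Measure.map_congr ?_
      filter_upwards [ae_restrict_mem (hlab (measurableSet_singleton w))] with ω hω
      have : labelsOn W H ω = w := hω
      simp [this]
    rw [hcongr, hs.map_themes_docs_restrict hf hci w]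
    refine Measure.ext_prod fun {A B} hA hB => ?_
    rw [Measure.map_apply (measurable_fst.prodMk (hF w)) (hA.prod hB),
      Measure.compProd_apply_prod hA hB,
      Measure.prod_apply ((measurable_fst.prodMk (hF w)) (hA.prod hB)), ← lintegral_indicator hA]
    refine lintegral_congr fun θ => ?_
    by_cases hθ : θ ∈ A
    · rw [Set.indicator_of_mem hθ, ← hκ w h0 θ,
        Measure.map_apply (f := fun y => F w (θ, y)) ((hF w).comp measurable_prodMk_left) hB]
      congr 1
      ext y
      simp [hθ]
    · rw [Set.indicator_of_notMem hθ]
      refine measure_mono_null (t := ∅) (fun y hy => hθ hy.1) measure_empty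
  have hsum : μ = Measure.sum fun w => μ.restrict (labelsOn W H ⁻¹' {w}) := by
    rw [← Measure.restrict_iUnion (fun w v hwv => ?_) fun w => hlab (measurableSet_singleton w)]
    · rw [← Set.preimage_iUnion, Set.iUnion_of_singleton, Set.preimage_univ, Measure.restrict_univ]
    · exact Disjoint.preimage _ (Set.disjoint_singleton.2 hwv)
  conv_lhs => rw [hsum]
  conv_rhs => rw [hsum]
  rw [Measure.map_sum (hf.prodMk hS).aemeasurable, Measure.map_sum hf.aemeasurable,
    Measure.compProd_sum_left]
  exact congrArg _ (funext hpiece)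

end IsSplitSample
end Conditioning

/-! ### Sums over labelled units -/

section Labels

variable {H : Type*} [Fintype H] {h₁ h₀ : ℕ}

/-- The labelling `w` has `h₁` treated and `h₀` control units. -/
def HasGroupSizes (w : H → Bool) (h₁ h₀ : ℕ) : Prop :=
  (Finset.univ.filter fun i => w i = true).card = h₁ ∧
    (Finset.univ.filter fun i => w i = false).card = h₀

@[to_additive]
lemma HasGroupSizes.prod_eq {w : H → Bool} (hw : HasGroupSizes w h₁ h₀) {M : Type*}
    [CommMonoid M] (φ : Bool → M) : ∏ i, φ (w i) = φ true ^ h₁ * φ false ^ h₀ := by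
  rw [← Finset.prod_fiberwise Finset.univ w, Fintype.prod_bool]
  congr 1
  · rw [← hw.1, ← Finset.prod_const]
    exact Finset.prod_congr rfl fun i hi => by rw [(Finset.mem_filter.1 hi).2]
  · rw [← hw.2, ← Finset.prod_const]
    exact Finset.prod_congr rfl fun i hi => by rw [(Finset.mem_filter.1 hi).2]

variable {𝒴 E : Type*} [MeasurableSpace 𝒴] {P : Bool → Measure 𝒴}
  [∀ w, IsProbabilityMeasure (P w)] [NormedAddCommGroup E] [InnerProductSpace ℝ E]
  [MeasurableSpace E] [BorelSpace E] [SecondCountableTopology E]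

/-- The law of a sum over the units depends on their labels through the group sizes only. -/
lemma HasGroupSizes.charFun_map_sum {w : H → Bool} (hw : HasGroupSizes w h₁ h₀)
    {g : Bool → 𝒴 → E} (hg : ∀ b, Measurable (g b)) (u : E) :
    charFun ((Measure.pi fun i => P (w i)).map fun y => ∑ i, g (w i) (y i)) u
      = charFun ((P true).map (g true)) u ^ h₁ * charFun ((P false).map (g false)) u ^ h₀ := by
  have hm : Measurable fun y : H → 𝒴 => ∑ i, g (w i) (y i) :=
    Finset.measurable_sum _ fun i _ => (hg _).comp (measurable_pi_apply i)
  rw [← hw.prod_eq fun b => charFun ((P b).map (g b)) u, charFun_apply,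
    integral_map hm.aemeasurable (by fun_prop)]
  have h (b : Bool) : charFun ((P b).map (g b)) u
      = ∫ y, Complex.exp (inner ℝ (g b y) u * Complex.I) ∂P b := by
    rw [charFun_apply, integral_map (hg b).aemeasurable (by fun_prop)]
  simp_rw [h]
  rw [← integral_fintype_prod_eq_prod]
  refine integral_congr_ae (ae_of_all _ fun y => ?_)
  simp only [sum_inner, ← Complex.exp_sum, Complex.ofReal_sum, Finset.sum_mul]

end Labels

/-! ### Centred scores and the estimation error for fixed themes -/

section Score

variable {𝒴 Θ : Type*} [MeasurableSpace 𝒴] {k : ℕ}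
  {score : Θ → 𝒴 → EuclideanSpace ℝ (Fin k)} {P : Bool → Measure 𝒴}
  [∀ w, IsProbabilityMeasure (P w)]

/-- The weight of one unit in the difference in means. -/
def unitWeight (h₁ h₀ : ℕ) (b : Bool) : ℝ := if b = true then 1 / (h₁ : ℝ) else -(1 / (h₀ : ℝ))

/-- The score of a document of group `b`, centred at its mean. -/
def centredScore (score : Θ → 𝒴 → EuclideanSpace ℝ (Fin k)) (P : Bool → Measure 𝒴) (θ : Θ)
    (b : Bool) (y : 𝒴) : EuclideanSpace ℝ (Fin k) :=
  score θ y - ∫ z, score θ z ∂P b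

/-- The estimation error of the difference in means, scaled by `r`, as a function of the labels, the
themes and the documents of the hold-out units. -/
def scaledError {H : Type*} [Fintype H] (score : Θ → 𝒴 → EuclideanSpace ℝ (Fin k))
    (P : Bool → Measure 𝒴) (h₁ h₀ : ℕ) (r : ℝ) (w : H → Bool) (p : Θ × (H → 𝒴)) :
    EuclideanSpace ℝ (Fin k) :=
  r • (∑ i, unitWeight h₁ h₀ (w i) • score p.1 (p.2 i) - effect score P p.1)

omit [∀ w, IsProbabilityMeasure (P w)] in
/-- Control units enter with a negative weight, so that the centring constants add up to the effect
when the group sizes are right. -/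
lemma HasGroupSizes.scaledError_eq {H : Type*} [Fintype H] {h₁ h₀ : ℕ} {w : H → Bool}
    (hw : HasGroupSizes w h₁ h₀) (h₁pos : 0 < h₁) (h₀pos : 0 < h₀) (r : ℝ) (θ : Θ) (y : H → 𝒴) :
    scaledError score P h₁ h₀ r w (θ, y)
      = ∑ i, (r * unitWeight h₁ h₀ (w i)) • centredScore score P θ (w i) (y i) := by
  have n1 : (h₁ : ℝ) ≠ 0 := by positivity
  have n0 : (h₀ : ℝ) ≠ 0 := by positivity
  have hmean : effect score P θ = ∑ i, unitWeight h₁ h₀ (w i) • ∫ z, score θ z ∂P (w i) := by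
    rw [hw.sum_eq fun b => unitWeight h₁ h₀ b • ∫ z, score θ z ∂P b]
    simp only [unitWeight, if_true, Bool.false_eq_true, if_false, ← Nat.cast_smul_eq_nsmul ℝ,
      smul_smul, mul_neg, mul_one_div_cancel n1, mul_one_div_cancel n0, one_smul, neg_one_smul]
    rw [effect, sub_eq_add_neg]
  simp only [scaledError, centredScore, mul_smul, ← Finset.smul_sum, smul_sub,
    Finset.sum_sub_distrib, ← hmean]

omit [∀ w, IsProbabilityMeasure (P w)] in
lemma measurable_smul_centredScore {θ : Θ} (hm : Measurable (score θ)) (a : ℝ) (b : Bool) :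
    Measurable fun y => a • centredScore score P θ b y :=
  Measurable.const_smul (hm.sub_const _) a

section Bounded

variable {c : ℝ} {θ : Θ}

lemma norm_le_of_abs_coord_le {x : EuclideanSpace ℝ (Fin k)} (hx : ∀ j, |x j| ≤ c) :
    ‖x‖ ≤ √(k * c ^ 2) := by
  rw [EuclideanSpace.norm_eq]
  refine Real.sqrt_le_sqrt ?_
  calc ∑ j, ‖x j‖ ^ 2 ≤ ∑ _j : Fin k, c ^ 2 := Finset.sum_le_sum fun j _ => by
        rw [Real.norm_eq_abs]; exact pow_le_pow_left₀ (abs_nonneg _) (hx j) 2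
    _ = _ := by simp

variable (hm : Measurable (score θ)) (hc : ∀ w, ∀ᵐ y ∂P w, ∀ j, |score θ y j| ≤ c)
include hc

lemma norm_centredScore_le (b : Bool) :
    ∀ᵐ y ∂P b, ‖centredScore score P θ b y‖ ≤ 2 * √(k * c ^ 2) := by
  have hb : ∀ᵐ y ∂P b, ‖score θ y‖ ≤ √(k * c ^ 2) :=
    (hc b).mono fun y hy => norm_le_of_abs_coord_le hy
  have hmean : ‖∫ y, score θ y ∂P b‖ ≤ √(k * c ^ 2) := by
    simpa using norm_integral_le_of_norm_le_const hb
  filter_upwards [hb] with y hy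
  calc _ ≤ _ := norm_sub_le _ _
    _ ≤ _ := by linarith

include hm

lemma integrable_score (b : Bool) : Integrable (score θ) (P b) :=
  Integrable.of_bound hm.aestronglyMeasurable _
    ((hc b).mono fun _ hy => norm_le_of_abs_coord_le hy)

lemma integrable_centredScore (b : Bool) : Integrable (centredScore score P θ b) (P b) :=
  (integrable_score hm hc b).sub (integrable_const _)

lemma integral_centredScore (b : Bool) : ∫ y, centredScore score P θ b y ∂P b = 0 := by
  simp only [centredScore]
  rw [integral_sub (integrable_score hm hc b) (integrable_const _)]
  simp

lemma secondMoment_map_centredScore (b : Bool) :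
    secondMoment ((P b).map (centredScore score P θ b)) = groupVar score P b θ := by
  have hmc : Measurable (centredScore score P θ b) := hm.sub_const _
  have hcoord (j : Fin k) : (∫ y, score θ y ∂P b) j = ∫ y, score θ y j ∂P b :=
    ((EuclideanSpace.proj (𝕜 := ℝ) j).integral_comp_comm (integrable_score hm hc b)).symm
  ext i j
  simp only [secondMoment, groupVar, Matrix.of_apply, covariance]
  rw [integral_map hmc.aemeasurable (by fun_prop)]
  simp only [centredScore, PiLp.sub_apply, hcoord]

end Bounded

end Score

/-! ### Conditional law, bias and normality of the difference in means -/

section Experiment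

variable {Ω 𝒴 Θ : Type*} [MeasurableSpace Ω] [MeasurableSpace 𝒴] [MeasurableSpace Θ] {n k : ℕ}
  {μ : Measure Ω} {P : Bool → Measure 𝒴}
  {Y : Fin n → Ω → 𝒴} {W : Fin n → Ω → Bool} {n₁ n₀ h₁ h₀ : ℕ} {H : Finset (Fin n)}
  {score : Θ → 𝒴 → EuclideanSpace ℝ (Fin k)} {fhat : Ω → Θ}

omit [MeasurableSpace Ω] [MeasurableSpace 𝒴] [MeasurableSpace Θ] in
lemma diffInMeans_eq_sum (ω : Ω) : diffInMeans score Y W h₁ h₀ H fhat ω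
    = ∑ i : H, unitWeight h₁ h₀ (labelsOn W H ω i) • score (fhat ω) (docsOn Y H ω i) := by
  have hterm (i : Fin n) : unitWeight h₁ h₀ (W i ω) • score (fhat ω) (Y i ω)
      = (1 / (h₁ : ℝ)) • (if W i ω = true then score (fhat ω) (Y i ω) else 0)
        - (1 / (h₀ : ℝ)) • (if W i ω = false then score (fhat ω) (Y i ω) else 0) := by
    cases W i ω <;> simp [unitWeight]
  have hsum := Finset.sum_coe_sort H fun i => unitWeight h₁ h₀ (W i ω) • score (fhat ω) (Y i ω)
  refine Eq.trans ?_ hsum.symm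
  simp only [hterm, Finset.sum_sub_distrib, ← Finset.smul_sum, ← Finset.sum_filter]
  rfl

omit [MeasurableSpace Ω] [MeasurableSpace Θ] in
lemma smul_diffInMeans_sub_effect (r : ℝ) : (fun ω => r • (diffInMeans score Y W h₁ h₀ H fhat ω
      - effect score P (fhat ω)))
    = fun ω => scaledError score P h₁ h₀ r (labelsOn W H ω) (fhat ω, docsOn Y H ω) :=
  funext fun ω => by rw [diffInMeans_eq_sum]; rfl

lemma measurable_effect [∀ w, IsProbabilityMeasure (P w)]
    (hscore : Measurable (Function.uncurry score)) : Measurable (effect score P) :=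
  have hb (b : Bool) : Measurable fun θ => ∫ y, score θ y ∂P b :=
    (hscore.stronglyMeasurable.integral_prod_right (ν := P b)).measurable
  (hb true).sub (hb false)

lemma measurable_scaledError [∀ w, IsProbabilityMeasure (P w)]
    (hscore : Measurable (Function.uncurry score)) (r : ℝ) (w : H → Bool) :
    Measurable (scaledError score P h₁ h₀ r w) := by
  have hi (i : H) : Measurable fun p : Θ × (H → 𝒴) => score p.1 (p.2 i) :=
    hscore.comp (f := fun p : Θ × (H → 𝒴) => (p.1, p.2 i)) (by fun_prop)
  exact Measurable.const_smul ((Finset.measurable_sum _ fun i _ =>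
    Measurable.const_smul (hi i) (unitWeight h₁ h₀ (w i))).sub
      ((measurable_effect hscore).comp measurable_fst)) r

lemma measurable_scaledError_section [∀ w, IsProbabilityMeasure (P w)]
    (hscore : Measurable (Function.uncurry score)) (r : ℝ) (w : H → Bool) (θ : Θ) :
    Measurable fun y => scaledError score P h₁ h₀ r w (θ, y) :=
  (measurable_scaledError hscore r w).comp measurable_prodMk_left

lemma exists_kernel_map_section {α β γ : Type*} [MeasurableSpace α] [MeasurableSpace β]
    [MeasurableSpace γ] (π : Measure β) [IsProbabilityMeasure π] {F : α × β → γ}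
    (hF : Measurable F) :
    ∃ κ : Kernel α γ, IsMarkovKernel κ ∧ ∀ a, κ a = π.map fun b => F (a, b) := by
  refine ⟨⟨fun a => π.map fun b => F (a, b), ?_⟩, ⟨fun a => ?_⟩, fun a => rfl⟩
  · refine Measure.measurable_of_measurable_coe _ fun s hs => ?_
    have h (a : α) : (π.map fun b => F (a, b)) s = π (Prod.mk a ⁻¹' (F ⁻¹' s)) :=
      Measure.map_apply (hF.comp measurable_prodMk_left) hs
    simp only [h]
    exact measurable_measure_prodMk_left (hF hs)
  · exact Measure.isProbabilityMeasure_map (hF.comp measurable_prodMk_left).aemeasurable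

namespace IsSplitSample

variable (hs : IsSplitSample μ P Y W n₁ n₀ h₁ h₀ H)
include hs

lemma ae_hasGroupSizes : ∀ᵐ ω ∂μ, HasGroupSizes (labelsOn W H ω) h₁ h₀ := by
  have hcard (ω : Ω) (b : Bool) : (Finset.univ.filter fun i : H => W i ω = b).card
      = (H.filter fun i => W i ω = b).card := by
    rw [Finset.card_filter, Finset.card_filter]
    exact Finset.sum_coe_sort H fun i => if W i ω = b then 1 else 0
  filter_upwards [hs.card_holdout_treated, hs.card_holdout_control] with ω h1 h0
  exact ⟨(hcard ω true).trans h1, (hcard ω false).trans h0⟩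

lemma hasGroupSizes_of_measure_ne_zero {w : H → Bool} (hw : μ (labelsOn W H ⁻¹' {w}) ≠ 0) :
    HasGroupSizes w h₁ h₀ := by
  by_contra hcon
  refine hw (measure_mono_null (fun ω hω => ?_) (ae_iff.1 hs.ae_hasGroupSizes))
  have : labelsOn W H ω = w := hω
  simpa [this] using hcon

lemma exists_hasGroupSizes [IsProbabilityMeasure μ] :
    ∃ w : H → Bool, HasGroupSizes w h₁ h₀ :=
  let ⟨ω, hω⟩ := hs.ae_hasGroupSizes.exists
  ⟨labelsOn W H ω, hω⟩

variable [∀ w, IsProbabilityMeasure (P w)] [IsProbabilityMeasure μ]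
  (hscore : Measurable (Function.uncurry score)) (hf : Measurable fhat)
  (hci : CondIndepGiven fhat (dataOn Y W H) (dataOn Y W Hᶜ) μ)
include hscore hf hci

/-- Given the themes, the scaled estimation error has the law that it would have for fixed themes
and any fixed labelling of the hold-out units with the right group sizes. -/
lemma condDistrib_scaledError (r : ℝ) {w : H → Bool} (hw : HasGroupSizes w h₁ h₀) :
    ∀ᵐ ω ∂μ, condDistrib (fun ω' => scaledError score P h₁ h₀ r (labelsOn W H ω')
        (fhat ω', docsOn Y H ω')) fhat μ (fhat ω)
      = (Measure.pi fun i => P (w i)).map fun y => scaledError score P h₁ h₀ r w (fhat ω, y) := by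
  obtain ⟨κ, hκm, hκ⟩ := exists_kernel_map_section (Measure.pi fun i => P (w i))
    (measurable_scaledError (h₁ := h₁) (h₀ := h₀) (P := P) hscore r w)
  simp only [← hκ]
  refine hs.condDistrib_ae_eq hf hci (measurable_scaledError hscore r) fun v hv θ => ?_
  have hv' := hs.hasGroupSizes_of_measure_ne_zero hv
  have hm (b : Bool) := measurable_smul_centredScore (P := P) (θ := θ)
    (hscore.comp measurable_prodMk_left) (r * unitWeight h₁ h₀ b) b
  have := fun v : H → Bool => Measure.isProbabilityMeasure_map (μ := Measure.pi fun i => P (v i))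
    (measurable_scaledError_section (h₁ := h₁) (h₀ := h₀) (P := P) hscore r v θ).aemeasurable
  rw [hκ]
  -- For every labelling, the characteristic function is the same product of two powers.
  refine Measure.ext_of_charFun (funext fun u => ?_)
  simp only [hv'.scaledError_eq hs.pos_treated hs.pos_control,
    hw.scaledError_eq hs.pos_treated hs.pos_control]
  rw [hv'.charFun_map_sum hm, hw.charFun_map_sum hm]

variable {c : ℝ} (hbound : ∀ᵐ ω ∂μ, ∀ w, ∀ᵐ y ∂(P w), ∀ j, |score (fhat ω) y j| ≤ c)
include hbound

/-- The estimation error is bounded almost surely. -/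
lemma integrable_scaledError (r : ℝ) : Integrable (fun ω => scaledError score P h₁ h₀ r
    (labelsOn W H ω) (fhat ω, docsOn Y H ω)) μ := by
  obtain ⟨w, hw⟩ := hs.exists_hasGroupSizes
  have hSm : Measurable fun ω => scaledError score P h₁ h₀ r (labelsOn W H ω)
      (fhat ω, docsOn Y H ω) := hs.measurable_statistic (measurable_scaledError hscore r) hf
  -- The law of the error given the themes is the one for the labelling `w`, which `K` bounds.
  set K : ℝ := ∑ i, ‖r * unitWeight h₁ h₀ (w i)‖ * (2 * √(k * c ^ 2)) with hK
  refine Integrable.of_bound hSm.aestronglyMeasurable K ?_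
  have hmeas : MeasurableSet {x : EuclideanSpace ℝ (Fin k) | ¬ ‖x‖ ≤ K} :=
    (measurableSet_le measurable_norm measurable_const).compl
  have hzero := setLIntegral_preimage_condDistrib (μ := μ) hf hSm.aemeasurable hmeas
    MeasurableSet.univ
  rw [Set.preimage_univ, Set.univ_inter, Measure.restrict_univ] at hzero
  rw [ae_iff]
  refine hzero.symm.trans ((lintegral_congr_ae ?_).trans lintegral_zero)
  filter_upwards [hs.condDistrib_scaledError hscore hf hci r hw, hbound] with ω hω hb
  rw [hω, Measure.map_apply (measurable_scaledError_section hscore r w _) hmeas]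
  suffices h : ∀ᵐ y ∂Measure.pi fun i => P (w i),
      ‖scaledError score P h₁ h₀ r w (fhat ω, y)‖ ≤ K from ae_iff.1 h
  have hall : ∀ᵐ y ∂Measure.pi fun i => P (w i), ∀ i,
      ‖centredScore score P (fhat ω) (w i) (y i)‖ ≤ 2 * √(k * c ^ 2) :=
    ae_all_iff.2 fun i => (Measure.tendsto_eval_ae_ae (μ := fun i => P (w i)) (i := i)).eventually
      (norm_centredScore_le hb (w i))
  filter_upwards [hall] with y hy
  rw [hw.scaledError_eq hs.pos_treated hs.pos_control]
  refine (norm_sum_le _ _).trans (Finset.sum_le_sum fun i _ => ?_)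
  rw [norm_smul]
  exact mul_le_mul_of_nonneg_left (hy i) (norm_nonneg _)

/-- The difference in means is conditionally unbiased. -/
lemma condExp_diffInMeans : Integrable (diffInMeans score Y W h₁ h₀ H fhat) μ ∧
    μ[diffInMeans score Y W h₁ h₀ H fhat | MeasurableSpace.comap fhat inferInstance]
      =ᵐ[μ] fun ω => effect score P (fhat ω) := by
  obtain ⟨w, hw⟩ := hs.exists_hasGroupSizes
  have hSint := hs.integrable_scaledError hscore hf hci hbound 1
  set S : Ω → EuclideanSpace ℝ (Fin k) := fun ω => scaledError score P h₁ h₀ 1 (labelsOn W H ω)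
    (fhat ω, docsOn Y H ω)
  have heffm : Measurable[MeasurableSpace.comap fhat inferInstance]
      fun ω => effect score P (fhat ω) :=
    (measurable_effect hscore).comp (comap_measurable fhat)
  have heffint : Integrable (fun ω => effect score P (fhat ω)) μ := by
    refine Integrable.of_bound (heffm.mono hf.comap_le le_rfl).aestronglyMeasurable
      (√(k * c ^ 2) + √(k * c ^ 2)) ?_
    filter_upwards [hbound] with ω hb
    have hmean (b : Bool) : ‖∫ y, score (fhat ω) y ∂P b‖ ≤ √(k * c ^ 2) := by
      simpa using norm_integral_le_of_norm_le_const
        ((hb b).mono fun y hy => norm_le_of_abs_coord_le hy)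
    exact (norm_sub_le _ _).trans (add_le_add (hmean true) (hmean false))
  have hD : diffInMeans score Y W h₁ h₀ H fhat = S + fun ω => effect score P (fhat ω) := by
    ext1 ω
    have h := congrFun (smul_diffInMeans_sub_effect (score := score) (P := P) (Y := Y) (W := W)
      (h₁ := h₁) (h₀ := h₀) (H := H) (fhat := fhat) 1) ω
    rw [one_smul] at h
    exact eq_add_of_sub_eq h
  have hS0 : μ[S | MeasurableSpace.comap fhat inferInstance] =ᵐ[μ] 0 := by
    refine (condExp_ae_eq_integral_condDistrib' hf hSint).trans ?_
    filter_upwards [hs.condDistrib_scaledError hscore hf hci 1 hw, hbound] with ω hω hb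
    have hm : Measurable (score (fhat ω)) := hscore.comp measurable_prodMk_left
    rw [hω, integral_map (measurable_scaledError_section hscore 1 w _).aemeasurable
      (by fun_prop)]
    simp only [hw.scaledError_eq hs.pos_treated hs.pos_control]
    have hi (i : H) : Integrable (fun y : H → 𝒴 => (1 * unitWeight h₁ h₀ (w i)) •
        centredScore score P (fhat ω) (w i) (y i)) (Measure.pi fun i => P (w i)) :=
      Integrable.smul (1 * unitWeight h₁ h₀ (w i)) (integrable_comp_eval (μ := fun i => P (w i))
        (integrable_centredScore hm hb (w i)))
    rw [integral_finsetSum _ fun i _ => hi i]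
    refine Finset.sum_eq_zero fun i _ => ?_
    rw [integral_smul, integral_comp_eval (μ := fun i => P (w i))
      (integrable_centredScore hm hb (w i)).aestronglyMeasurable, integral_centredScore hm hb,
      smul_zero]
  refine ⟨hD ▸ hSint.add heffint, ?_⟩
  rw [hD]
  refine (condExp_add hSint heffint _).trans ?_
  rw [condExp_of_stronglyMeasurable hf.comap_le heffm.stronglyMeasurable heffint]
  filter_upwards [hS0] with ω hω
  simp [hω]

/-- The central limit theorem for fixed themes, transported to the conditional distribution. -/
lemma ae_cdfDist_le {ε η : ℝ} (hε : 0 < ε) (hη : 0 < η)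
    (hvar : ∀ᵐ ω ∂μ, ∀ w, (groupVar score P w (fhat ω)
      - ε • (1 : Matrix (Fin k) (Fin k) ℝ)).PosSemidef)
    (hN : (exists_forall_cdfDist_le k (2 * √(k * c ^ 2)) hε hη).choose ≤ min h₁ h₀) :
    ∀ᵐ ω ∂μ, cdfDist (condDistrib (fun ω' => √((min h₁ h₀ : ℕ) : ℝ) •
        (diffInMeans score Y W h₁ h₀ H fhat ω' - effect score P (fhat ω'))) fhat μ (fhat ω))
      (multivariateGaussian 0 (asympVar score P h₁ h₀ (fhat ω))) ≤ η := by
  obtain ⟨w, hw⟩ := hs.exists_hasGroupSizes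
  rw [smul_diffInMeans_sub_effect]
  filter_upwards [hs.condDistrib_scaledError hscore hf hci (√((min h₁ h₀ : ℕ) : ℝ)) hw, hbound,
    hvar] with ω hω hb hv
  have hm : Measurable (score (fhat ω)) := hscore.comp measurable_prodMk_left
  have hmc (b : Bool) : Measurable (centredScore score P (fhat ω) b) := hm.sub_const _
  let Q : Bool → Measure (EuclideanSpace ℝ (Fin k)) :=
    fun b => (P b).map (centredScore score P (fhat ω) b)
  have hQ : asympVar score P h₁ h₀ (fhat ω) = pooledMoment Q h₁ h₀ := by
    simp only [asympVar, pooledMoment, Q, secondMoment_map_centredScore hm hb]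
  rw [hω, hQ]
  refine (exists_forall_cdfDist_le k (2 * √(k * c ^ 2)) hε hη).choose_spec h₁ h₀ hN
    (lt_min hs.pos_treated hs.pos_control) Q _
    (fun b => Measure.isProbabilityMeasure_map (hmc b).aemeasurable)
    (Measure.isProbabilityMeasure_map
      (measurable_scaledError_section hscore _ w _).aemeasurable)
    (fun b => ?_) (fun b => ?_) (fun b => ?_) fun u => ?_
  · exact (ae_map_iff (hmc b).aemeasurable (measurableSet_le measurable_norm measurable_const)).2
      (norm_centredScore_le hb b)
  · simp only [Q]
    rw [integral_map (hmc b).aemeasurable (by fun_prop)]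
    exact integral_centredScore hm hb b
  · simpa only [Q, secondMoment_map_centredScore hm hb] using hv b
  · simp only [hw.scaledError_eq hs.pos_treated hs.pos_control]
    rw [hw.charFun_map_sum (g := fun b y => (√((min h₁ h₀ : ℕ) : ℝ) * unitWeight h₁ h₀ b) •
      centredScore score P (fhat ω) b y) fun b =>
        measurable_smul_centredScore hm _ b]
    simp only [charFun_map_smul_comp (hmc _).aemeasurable, Q, unitWeight, if_true,
      Bool.false_eq_true, if_false, mul_neg, mul_one_div]

end IsSplitSample
end Experiment

end TextThemes

end

theorem proposition2
    {k : ℕ} {𝒴 Θ : Type*} [MeasurableSpace 𝒴] [MeasurableSpace Θ]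
    -- themes `θ` score a document `y` by `score θ y`
    (score : Θ → 𝒴 → EuclideanSpace ℝ (Fin k))
    (hscore : Measurable (Function.uncurry score))
    -- a family of experiments, with an arbitrary mode of passing to the limit
    {ι : Type*} (l : Filter ι)
    (Ω : ι → Type*) [∀ r, MeasurableSpace (Ω r)]
    (μ : ∀ r, Measure (Ω r)) [∀ r, IsProbabilityMeasure (μ r)]
    (P : ι → Bool → Measure 𝒴) [∀ r w, IsProbabilityMeasure (P r w)]
    (n n₁ n₀ h₁ h₀ : ι → ℕ)
    (Y : ∀ r, Fin (n r) → Ω r → 𝒴) (W : ∀ r, Fin (n r) → Ω r → Bool)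
    (H : ∀ r, Finset (Fin (n r)))
    (hsample : ∀ r, TextThemes.IsSplitSample (μ r) (P r) (Y r) (W r)
      (n₁ r) (n₀ r) (h₁ r) (h₀ r) (H r))
    -- the themes are learned from the training data only
    (fhat : ∀ r, Ω r → Θ) (hfhat : ∀ r, Measurable (fhat r))
    (htrain : ∀ r, TextThemes.CondIndepGiven (fhat r) (TextThemes.dataOn (Y r) (W r) (H r))
      (TextThemes.dataOn (Y r) (W r) (H r)ᶜ) (μ r))
    -- scores are uniformly bounded
    (c : ℝ)
    (hbound : ∀ r, ∀ᵐ ω ∂(μ r), ∀ w, ∀ᵐ y ∂(P r w), ∀ j, |score (fhat r ω) y j| ≤ c)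
    -- their variances within the groups are uniformly bounded away from zero
    (ε : ℝ) (hε : 0 < ε)
    (hvar : ∀ r, ∀ᵐ ω ∂(μ r), ∀ w,
      (TextThemes.groupVar score (P r) w (fhat r ω)
        - ε • (1 : Matrix (Fin k) (Fin k) ℝ)).PosSemidef) :
    -- conditional unbiasedness
    (∀ r, Integrable
        (TextThemes.diffInMeans score (Y r) (W r) (h₁ r) (h₀ r) (H r) (fhat r)) (μ r) ∧
      (μ r)[TextThemes.diffInMeans score (Y r) (W r) (h₁ r) (h₀ r) (H r) (fhat r) |
          MeasurableSpace.comap (fhat r) inferInstance]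
        =ᵐ[μ r] fun ω => TextThemes.effect score (P r) (fhat r ω)) ∧
    -- conditional asymptotic normality
    (Tendsto (fun r => min (h₁ r) (h₀ r)) l atTop →
      ∀ δ : ℝ, 0 < δ →
        Tendsto (fun r => (μ r) {ω | δ ≤ TextThemes.cdfDist
            (condDistrib
              (fun ω' => √((min (h₁ r) (h₀ r) : ℕ) : ℝ) •
                (TextThemes.diffInMeans score (Y r) (W r) (h₁ r) (h₀ r) (H r) (fhat r) ω'
                  - TextThemes.effect score (P r) (fhat r ω')))
              (fhat r) (μ r) (fhat r ω))
            (multivariateGaussian 0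
              (TextThemes.asympVar score (P r) (h₁ r) (h₀ r) (fhat r ω)))})
          l (𝓝 0)) := by
  refine ⟨fun r => (hsample r).condExp_diffInMeans hscore (hfhat r) (htrain r) (hbound r),
    fun hlim δ hδ => ?_⟩
  refine tendsto_const_nhds.congr' ?_
  filter_upwards [hlim.eventually_ge_atTop
    (TextThemes.exists_forall_cdfDist_le k (2 * √(k * c ^ 2)) hε (half_pos hδ)).choose] with r hr
  have h := (hsample r).ae_cdfDist_le hscore (hfhat r) (htrain r) (hbound r) hε (half_pos hδ)
    (hvar r) hr
  refine (measure_mono_null (fun ω hω => ?_) (ae_iff.1 h)).symm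
  have hω' : δ ≤ _ := hω
  exact not_le.2 ((half_lt_self hδ).trans_le hω')
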